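/- Let $L>0$, $T>0$ and let $g\in L^2((0,L)\times(0,L))$ be complex-valued. Consider the system $$\text{(D)}\qquad u_t(t,x)-u_x(t,x)=\int_0^L g(x,y)u(t,y)\,dy,\qquad u(t,L)=U(t),\qquad u(0,x)=u^0(x),$$ and the system with periodic-type boundary condition $$\text{(P)}\qquad \tilde u_t(t,x)-\tilde u_x(t,x)=\int_0^L g(x,y)\tilde u(t,y)\,dy,\qquad \tilde u(t,L)-\tilde u(t,0)=\tilde U(t),\qquad \tilde u(0,x)=\tilde u^0(x),$$ for $t\in(0,T)$, $x\in(0,L)$, with complex-valued data $u^0,\tilde u^0\in L^2(0,L)$ and controls $U,\tilde U\in L^2(0,T)$. A (weak) solution of (D) is a function $u\in C^0([0,T];L^2(0,L))$ such that for every $\tau\in[0,T]$ $$\int_0^\tau\!\!\int_0^L u(t,x)\overline{\Big(-\phi_t(t,x)+\phi_x(t,x)-\int_0^L\overline{g(y,x)}\phi(t,y)\,dy\Big)}dx\,dt+\int_0^L u(\tau,x)\overline{\phi(\tau,x)}\,dx-\int_0^L u^0(x)\overline{\phi(0,x)}\,dx-\int_0^\tau U(t)\overline{\phi(t,L)}\,dt=0$$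 for every $\phi\in C^1([0,\tau]\times[0,L])$ with $\phi(\cdot,0)=0$. A solution of (P) is defined by the same identity (with $\tilde u,\tilde u^0,\tilde U$ in place of $u,u^0,U$), required for every $\phi\in C^1([0,\tau]\times[0,L])$ with $\phi(\cdot,L)=\phi(\cdot,0)$ instead. Each system is called exactly controllable at time $T$ if for all $u^0,u^1\in L^2(0,L)$ there exist a control in $L^2(0,T)$ and a corresponding solution, with initial datum $u^0$, whose value at time $T$ is $u^1$. Then (D) is exactly controllable at time $T$ if and only if (P) is exactly controllable at time $T$. -/

import Mathlib

open Set MeasureTheory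
open scoped ComplexConjugate ENNReal

noncomputable section

namespace IntegroHyperbolic

/-- The complex Lebesgue space `L²(0, a)`; it is the state space for `a = L` and the space of
controls for `a = T`. -/
abbrev L2 (a : ℝ) : Type := Lp ℂ 2 ((volume : Measure ℝ).restrict (Ioo 0 a))

/-- The formal adjoint of `∂ₜ - ∂ₓ - ∫₀ᴸ g(·, y) · dy` applied to `φ` at `(t, x)`:
`-φₜ(t, x) + φₓ(t, x) - ∫₀ᴸ conj (g(y, x)) φ(t, y) dy`. It is only used at interior points of the
rectangle on which `φ` is of class `C¹`, so that `deriv` is the partial derivative there. -/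
def adjointOp (L : ℝ) (g : ℝ → ℝ → ℂ) (φ : ℝ → ℝ → ℂ) (t x : ℝ) : ℂ :=
  -deriv (fun s => φ s x) t + deriv (fun y => φ t y) x
    - ∫ y in Ioo 0 L, conj (g y x) * φ t y

/-- `φ` belongs to `C¹([0, τ] × [0, L])`. -/
def IsTestFunction (L τ : ℝ) (φ : ℝ → ℝ → ℂ) : Prop :=
  ContDiffOn ℝ 1 (fun p : ℝ × ℝ => φ p.1 p.2) (Icc 0 τ ×ˢ Icc 0 L)

/-- The left-hand side of the integral identity that defines weak solutions, on `[0, τ]`, for the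
state `u`, the initial datum `u₀`, the control `U` and the test function `φ`. -/
def weakForm {L T : ℝ} (g : ℝ → ℝ → ℂ) (u₀ : L2 L) (U : L2 T) (u : ℝ → L2 L) (τ : ℝ)
    (φ : ℝ → ℝ → ℂ) : ℂ :=
  (∫ t in Ioo 0 τ, ∫ x in Ioo 0 L, u t x * conj (adjointOp L g φ t x))
    + (∫ x in Ioo 0 L, u τ x * conj (φ τ x))
    - (∫ x in Ioo 0 L, u₀ x * conj (φ 0 x))
    - ∫ t in Ioo 0 τ, U t * conj (φ t L)

/-- `u ∈ C⁰([0, T]; L²(0, L))` is a weak solution of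
`uₜ - uₓ = ∫₀ᴸ g(·, y) u(t, y) dy`, `u(t, L) = U(t)`, `u(0, ·) = u₀`. -/
def IsDirichletSolution {L T : ℝ} (g : ℝ → ℝ → ℂ) (u₀ : L2 L) (U : L2 T) (u : ℝ → L2 L) : Prop :=
  ContinuousOn u (Icc 0 T) ∧
    ∀ τ ∈ Icc 0 T, ∀ φ : ℝ → ℝ → ℂ, IsTestFunction L τ φ → (∀ t ∈ Icc 0 τ, φ t 0 = 0) →
      weakForm g u₀ U u τ φ = 0

/-- `u ∈ C⁰([0, T]; L²(0, L))` is a weak solution of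
`uₜ - uₓ = ∫₀ᴸ g(·, y) u(t, y) dy`, `u(t, L) - u(t, 0) = U(t)`, `u(0, ·) = u₀`. -/
def IsPeriodicSolution {L T : ℝ} (g : ℝ → ℝ → ℂ) (u₀ : L2 L) (U : L2 T) (u : ℝ → L2 L) : Prop :=
  ContinuousOn u (Icc 0 T) ∧
    ∀ τ ∈ Icc 0 T, ∀ φ : ℝ → ℝ → ℂ, IsTestFunction L τ φ → (∀ t ∈ Icc 0 τ, φ t L = φ t 0) →
      weakForm g u₀ U u τ φ = 0

/-- Exact controllability at time `T` of the system with boundary condition `u(t, L) = U(t)`. -/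
def DirichletExactlyControllable (L T : ℝ) (g : ℝ → ℝ → ℂ) : Prop :=
  ∀ u₀ u₁ : L2 L, ∃ (U : L2 T) (u : ℝ → L2 L), IsDirichletSolution g u₀ U u ∧ u T = u₁

/-- Exact controllability at time `T` of the system with boundary condition
`u(t, L) - u(t, 0) = U(t)`. -/
def PeriodicExactlyControllable (L T : ℝ) (g : ℝ → ℝ → ℂ) : Prop :=
  ∀ u₀ u₁ : L2 L, ∃ (U : L2 T) (u : ℝ → L2 L), IsPeriodicSolution g u₀ U u ∧ u T = u₁

end IntegroHyperbolic

end

noncomputable section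

namespace IntegroHyperbolic

/-! The two systems have the same trajectories: a solution of either is a solution of the other for
a suitable control. Formally `U = u(·, L)` for (D) and `U = u(·, L) - u(·, 0)` for (P), so
everything reduces to giving `u(·, 0)` a meaning in `L²(0, T)`. No well-posedness theory is needed.

This hidden regularity is `exists_boundary_trace`, stated for adjoint boundary conditions `φ(t, 0) =
c φ(t, L)`, with `c = 0` for (D) and `c = 1` for (P). Take test functions `weight L x * h (t + x)`.
Since `h (t + x)` is constant along the characteristics, the transport operator differentiates only
the weight, and the weak form is `L²`-continuous in `h`. It is therefore the inner product of `h`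
with an explicit `w τ` in `L²(ℝ)` (`weakForm_weight_mul`). Given any `φ`, choose `h = φ(·, 0) - c
φ(·, L)` on `[0, τ]`. Subtracting the weighted profile makes `φ` admissible, so its weak form is
that inner product. Finally `w τ` vanishes beyond `τ` and agrees with `w T` on `(0, τ)`, so a single
`v`, formally `-u(·, 0)`, serves every `τ`. -/

theorem enorm_integral_mul_le {β : Type*} [MeasurableSpace β] {ν : Measure β} {f h : β → ℂ}
    (hf : AEStronglyMeasurable f ν) (hh : AEStronglyMeasurable h ν) :
    ‖∫ y, f y * h y ∂ν‖ₑ ≤ eLpNorm f 2 ν * eLpNorm h 2 ν := by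
  refine (enorm_integral_le_lintegral_enorm _).trans ?_
  rw [← eLpNorm_one_eq_lintegral_enorm]
  have h := eLpNorm_smul_le_mul_eLpNorm (p := 2) (q := 2) (r := 1) hh hf
  exact h

/-! ### Square-integrable kernels as bounded operators -/

section KernelOperator

variable {α β : Type*} [MeasurableSpace α] [MeasurableSpace β] {μ : Measure α} {ν : Measure β}
  [SFinite ν]

theorem lintegral_eLpNorm_sq_eq {k : α → β → ℂ}
    (hk : AEStronglyMeasurable (fun p : α × β => k p.1 p.2) (μ.prod ν)) :
    ∫⁻ x, eLpNorm (k x) 2 ν ^ (2 : ℝ) ∂μ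
      = eLpNorm (fun p : α × β => k p.1 p.2) 2 (μ.prod ν) ^ (2 : ℝ) := by
  have h2 : ((2 : ℝ≥0∞)).toReal = 2 := by simp
  simp only [eLpNorm_eq_lintegral_rpow_enorm_toReal two_ne_zero ENNReal.ofNat_ne_top, h2,
    ← ENNReal.rpow_mul]
  norm_num
  rw [lintegral_prod]
  exact (hk.enorm.pow_const 2)

theorem aemeasurable_eLpNorm_section {k : α → β → ℂ}
    (hk : AEStronglyMeasurable (fun p : α × β => k p.1 p.2) (μ.prod ν)) :
    AEMeasurable (fun x => eLpNorm (k x) 2 ν ^ (2 : ℝ)) μ := by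
  have h2 : ((2 : ℝ≥0∞)).toReal = 2 := by simp
  simp only [eLpNorm_eq_lintegral_rpow_enorm_toReal two_ne_zero ENNReal.ofNat_ne_top, h2,
    ← ENNReal.rpow_mul]
  norm_num
  exact (hk.enorm.pow_const 2).lintegral_prod_right'

theorem ae_memLp_section {k : α → β → ℂ} (hk : MemLp (fun p : α × β => k p.1 p.2) 2 (μ.prod ν)) :
    ∀ᵐ x ∂μ, MemLp (k x) 2 ν := by
  have hfin : ∫⁻ x, eLpNorm (k x) 2 ν ^ (2 : ℝ) ∂μ ≠ ∞ := by
    rw [lintegral_eLpNorm_sq_eq hk.1]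
    exact ENNReal.rpow_ne_top_of_nonneg (by norm_num) hk.2.ne
  filter_upwards [hk.1.prodMk_left,
    ae_lt_top' (aemeasurable_eLpNorm_section hk.1) hfin] with x hx hx'
  refine ⟨hx, ?_⟩
  by_contra hcon
  rw [not_lt, top_le_iff] at hcon
  simp [hcon] at hx'

theorem eLpNorm_integral_kernel_le {k : α → β → ℂ}
    (hk : MemLp (fun p : α × β => k p.1 p.2) 2 (μ.prod ν)) {ψ : β → ℂ}
    (hψ : MemLp ψ 2 ν) :
    eLpNorm (fun x => ∫ y, k x y * ψ y ∂ν) 2 μ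
      ≤ eLpNorm (fun p : α × β => k p.1 p.2) 2 (μ.prod ν) * eLpNorm ψ 2 ν := by
  have h2 : ((2 : ℝ≥0∞)).toReal = 2 := by simp
  rw [eLpNorm_eq_lintegral_rpow_enorm_toReal two_ne_zero ENNReal.ofNat_ne_top, h2]
  refine (ENNReal.rpow_le_rpow (lintegral_mono_ae (g := fun x =>
    eLpNorm (k x) 2 ν ^ (2 : ℝ) * eLpNorm ψ 2 ν ^ (2 : ℝ)) ?_) (by norm_num)).trans ?_
  · filter_upwards [hk.1.prodMk_left] with x hx
    rw [← ENNReal.mul_rpow_of_nonneg _ _ (by norm_num)]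
    exact ENNReal.rpow_le_rpow (enorm_integral_mul_le hx hψ.1) (by norm_num)
  · rw [lintegral_mul_const' _ _ (ENNReal.rpow_ne_top_of_nonneg (by norm_num) hψ.2.ne),
      lintegral_eLpNorm_sq_eq hk.1, ← ENNReal.mul_rpow_of_nonneg _ _ (by norm_num),
      ← ENNReal.rpow_mul]
    norm_num

/-- A square-integrable kernel defines a bounded operator between `L²` spaces. -/
theorem exists_kernel_operator {k : α → β → ℂ}
    (hk : MemLp (fun p : α × β => k p.1 p.2) 2 (μ.prod ν)) :
    ∃ K : Lp ℂ 2 ν →L[ℂ] Lp ℂ 2 μ, ∀ ψ : Lp ℂ 2 ν, K ψ =ᵐ[μ] fun x => ∫ y, k x y * ψ y ∂ν := by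
  have hmem : ∀ ψ : Lp ℂ 2 ν, MemLp (fun x => ∫ y, k x y * ψ y ∂ν) 2 μ := fun ψ =>
    ⟨AEStronglyMeasurable.integral_prod_right'
        (f := fun p : α × β => k p.1 p.2 * ψ p.2) (hk.1.mul (Lp.aestronglyMeasurable ψ).comp_snd),
      (eLpNorm_integral_kernel_le hk (Lp.memLp ψ)).trans_lt
        (ENNReal.mul_lt_top hk.2 (Lp.eLpNorm_lt_top ψ))⟩
  -- The null set must not depend on `ψ`; it is the set of `x` whose section is not in `L²`.
  have hint : ∀ᵐ x ∂μ, ∀ ψ : Lp ℂ 2 ν, Integrable (fun y => k x y * ψ y) ν := by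
    filter_upwards [ae_memLp_section hk] with x hx ψ
    exact hx.integrable_mul (Lp.memLp ψ)
  let K₀ : Lp ℂ 2 ν →ₗ[ℂ] Lp ℂ 2 μ :=
    { toFun := fun ψ => (hmem ψ).toLp
      map_add' := fun ψ₁ ψ₂ => by
        rw [← MemLp.toLp_add]
        refine MemLp.toLp_congr _ _ ?_
        filter_upwards [hint] with x hx
        rw [Pi.add_apply, ← integral_add (hx ψ₁) (hx ψ₂)]
        refine integral_congr_ae ?_
        filter_upwards [Lp.coeFn_add ψ₁ ψ₂] with y hy
        rw [hy, Pi.add_apply, mul_add]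
      map_smul' := fun c ψ => by
        rw [RingHom.id_apply, ← MemLp.toLp_const_smul]
        refine MemLp.toLp_congr _ _ (Filter.Eventually.of_forall fun x => ?_)
        rw [Pi.smul_apply, ← integral_smul]
        refine integral_congr_ae ?_
        filter_upwards [Lp.coeFn_smul c ψ] with y hy
        simp only [hy, Pi.smul_apply, smul_eq_mul]
        ring }
  refine ⟨K₀.mkContinuous (eLpNorm (fun p : α × β => k p.1 p.2) 2 (μ.prod ν)).toReal ?_,
    fun ψ => (hmem ψ).coeFn_toLp⟩
  intro ψ
  change ‖(hmem ψ).toLp‖ ≤ _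
  rw [Lp.norm_toLp, Lp.norm_def, ← ENNReal.toReal_mul]
  exact ENNReal.toReal_mono (ENNReal.mul_ne_top hk.2.ne (Lp.eLpNorm_ne_top ψ))
    (eLpNorm_integral_kernel_le hk (Lp.memLp ψ))

end KernelOperator

/-! ### Translations on the line -/

/-- Translation on `L²(ℝ)`: `translate t H` is `x ↦ H (t + x)`. -/
def translate (t : ℝ) : Lp ℂ 2 (volume : Measure ℝ) →ₗᵢ[ℂ] Lp ℂ 2 (volume : Measure ℝ) :=
  Lp.compMeasurePreservingₗᵢ ℂ (fun x => t + x) (measurePreserving_add_left volume t)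

theorem coeFn_translate (t : ℝ) (H : Lp ℂ 2 (volume : Measure ℝ)) :
    translate t H =ᵐ[volume] fun x => H (t + x) :=
  Lp.coeFn_compMeasurePreserving _ _

theorem translate_translate_neg (t : ℝ) (H : Lp ℂ 2 (volume : Measure ℝ)) :
    translate t (translate (-t) H) = H := by
  refine Lp.ext ?_
  have h := (measurePreserving_add_left volume t).quasiMeasurePreserving.ae_eq_comp
    (coeFn_translate (-t) H)
  filter_upwards [coeFn_translate t (translate (-t) H), h] with x hx hx'
  rw [hx]
  simpa using hx'

theorem inner_translate_neg (t : ℝ) (H G : Lp ℂ 2 (volume : Measure ℝ)) :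
    inner ℂ H (translate (-t) G) = inner ℂ (translate t H) G := by
  rw [← (translate t).inner_map_map H, translate_translate_neg]

theorem continuousOn_translate {s : Set ℝ} {a : ℝ → ℝ} {F : ℝ → Lp ℂ 2 (volume : Measure ℝ)}
    (ha : ContinuousOn a s) (hF : ContinuousOn F s) :
    ContinuousOn (fun t => translate (a t) (F t)) s := by
  have hc : Continuous fun t : ℝ => (⟨fun x => t + x, by fun_prop⟩ : C(ℝ, ℝ)) :=
    ((ContinuousMap.mk (fun p : ℝ × ℝ => p.1 + p.2) continuous_add).curry).continuous
  exact hF.compMeasurePreservingLp (hc.comp_continuousOn ha)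
    (fun t => measurePreserving_add_left volume (a t)) ENNReal.ofNat_ne_top

/-! ### Test functions as continuous curves in `L²(0, L)` -/

theorem exists_continuousOn_L2 {τ L : ℝ} {f : ℝ → ℝ → ℂ}
    (hf : ContinuousOn (fun p : ℝ × ℝ => f p.1 p.2) (Icc 0 τ ×ˢ Icc 0 L)) :
    ∃ F : ℝ → L2 L, ContinuousOn F (Icc 0 τ) ∧
      ∀ t ∈ Icc 0 τ, F t =ᵐ[volume.restrict (Ioo 0 L)] f t := by
  have hmem : ∀ t ∈ Icc 0 τ, MemLp (f t) 2 (volume.restrict (Ioo 0 L)) := by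
    intro t ht
    have hcont : ContinuousOn (f t) (Icc 0 L) :=
      hf.comp (f := fun x => (t, x)) (by fun_prop) fun x hx => ⟨ht, hx⟩
    obtain ⟨C, hC⟩ := isCompact_Icc.exists_bound_of_continuousOn hcont
    refine MemLp.of_bound ((hcont.mono Ioo_subset_Icc_self).aestronglyMeasurable
      measurableSet_Ioo) C ?_
    filter_upwards [ae_restrict_mem measurableSet_Ioo] with x hx
    exact hC x (Ioo_subset_Icc_self hx)
  classical
  refine ⟨fun t => if ht : t ∈ Icc 0 τ then (hmem t ht).toLp else 0, ?_, ?_⟩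
  · have hu := (isCompact_Icc.prod isCompact_Icc).uniformContinuousOn_of_continuous hf
    rw [Metric.uniformContinuousOn_iff] at hu
    rw [Metric.continuousOn_iff]
    intro t ht ε hε
    set m : ℝ := measureUnivNNReal ((volume : Measure ℝ).restrict (Ioo 0 L)) ^ (2 : ℝ≥0∞).toReal⁻¹
    have hm : 0 ≤ m := by positivity
    -- Here `m` is the `L²` norm of the constant `1`; dividing by `m + 1` keeps the final bound
    -- strict and covers `m = 0`.
    obtain ⟨δ, hδ, h⟩ := hu (ε / (m + 1)) (by positivity)
    refine ⟨δ, hδ, fun s hs hst => ?_⟩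
    simp only [dif_pos hs, dif_pos ht]
    rw [dist_eq_norm, ← MemLp.toLp_sub]
    refine (Lp.norm_le_of_ae_bound (C := ε / (m + 1)) (by positivity) ?_).trans_lt ?_
    · filter_upwards [((hmem s hs).sub (hmem t ht)).coeFn_toLp,
        ae_restrict_mem measurableSet_Ioo] with x hx hxL
      rw [hx, Pi.sub_apply, ← dist_eq_norm]
      refine (h (s, x) ⟨hs, Ioo_subset_Icc_self hxL⟩ (t, x) ⟨ht, Ioo_subset_Icc_self hxL⟩ ?_).le
      simpa [Prod.dist_eq] using hst
    · change m * (ε / (m + 1)) < ε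
      rw [mul_div_assoc', div_lt_iff₀ (by positivity)]
      nlinarith
  · intro t ht
    simp only [dif_pos ht]
    exact (hmem t ht).coeFn_toLp

theorem IsTestFunction.hasFDerivAt {L τ t x : ℝ} {φ : ℝ → ℝ → ℂ} (hφ : IsTestFunction L τ φ)
    (ht : t ∈ Ioo 0 τ) (hx : x ∈ Ioo 0 L) :
    HasFDerivAt (fun p : ℝ × ℝ => φ p.1 p.2)
      (fderivWithin ℝ (fun p : ℝ × ℝ => φ p.1 p.2) (Icc 0 τ ×ˢ Icc 0 L) (t, x)) (t, x) := by
  have hn : Icc 0 τ ×ˢ Icc 0 L ∈ nhds (t, x) :=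
    prod_mem_nhds (Icc_mem_nhds ht.1 ht.2) (Icc_mem_nhds hx.1 hx.2)
  exact ((ContDiffOn.differentiableOn hφ one_ne_zero) (t, x)
    (mem_of_mem_nhds hn)).hasFDerivWithinAt.hasFDerivAt hn

theorem IsTestFunction.differentiableAt_left {L τ t x : ℝ} {φ : ℝ → ℝ → ℂ}
    (hφ : IsTestFunction L τ φ) (ht : t ∈ Ioo 0 τ) (hx : x ∈ Ioo 0 L) :
    DifferentiableAt ℝ (fun s => φ s x) t :=
  (hφ.hasFDerivAt ht hx).differentiableAt.comp (f := fun s => (s, x)) t (by fun_prop)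

theorem IsTestFunction.differentiableAt_right {L τ t x : ℝ} {φ : ℝ → ℝ → ℂ}
    (hφ : IsTestFunction L τ φ) (ht : t ∈ Ioo 0 τ) (hx : x ∈ Ioo 0 L) :
    DifferentiableAt ℝ (fun y => φ t y) x :=
  (hφ.hasFDerivAt ht hx).differentiableAt.comp (f := fun y => (t, y)) x (by fun_prop)

theorem IsTestFunction.integrableOn_mul {L T τ : ℝ} (hτ : τ ∈ Icc 0 T)
    {φ : ℝ → ℝ → ℂ} (hφ : IsTestFunction L τ φ) (U : L2 T) {x : ℝ} (hx : x ∈ Icc 0 L) :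
    IntegrableOn (fun t => U t * conj (φ t x)) (Ioo 0 τ) := by
  have hcont : ContinuousOn (fun t => φ t x) (Icc 0 τ) :=
    (ContDiffOn.continuousOn hφ).comp (f := fun t => (t, x)) (by fun_prop) fun t ht => ⟨ht, hx⟩
  obtain ⟨C, hC⟩ := isCompact_Icc.exists_bound_of_continuousOn hcont
  have h1 : MemLp (fun t => conj (φ t x)) 2 (volume.restrict (Ioo 0 τ)) := by
    refine MemLp.of_bound (((Complex.continuous_conj.comp_continuousOn hcont).mono
      Ioo_subset_Icc_self).aestronglyMeasurable measurableSet_Ioo) C ?_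
    filter_upwards [ae_restrict_mem measurableSet_Ioo] with t ht
    rw [RCLike.norm_conj]
    exact hC t (Ioo_subset_Icc_self ht)
  exact ((Lp.memLp U).mono_measure
    (Measure.restrict_mono (Ioo_subset_Ioo_right hτ.2) le_rfl)).integrable_mul h1

/-- The within-derivative is continuous up to the boundary of the rectangle, whereas `deriv` is
controlled only inside; hence `D` is identified on the open interval only. -/
theorem exists_test_representatives {L τ : ℝ} (hL : 0 < L) (hτ : 0 ≤ τ) {φ : ℝ → ℝ → ℂ}
    (hφ : IsTestFunction L τ φ) :
    ∃ Φ D : ℝ → L2 L, ContinuousOn Φ (Icc 0 τ) ∧ ContinuousOn D (Icc 0 τ) ∧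
      (∀ t ∈ Icc 0 τ, Φ t =ᵐ[volume.restrict (Ioo 0 L)] φ t) ∧
      (∀ t ∈ Ioo 0 τ, D t =ᵐ[volume.restrict (Ioo 0 L)]
        fun x => -deriv (fun s => φ s x) t + deriv (fun y => φ t y) x) := by
  obtain ⟨Φ, hΦ, hΦ'⟩ := exists_continuousOn_L2 (ContDiffOn.continuousOn hφ)
  rcases hτ.eq_or_lt with rfl | hτ
  -- A degenerate rectangle has no unique derivative, but then `Ioo 0 τ` is empty and any `D` works.
  · exact ⟨Φ, 0, hΦ, continuousOn_const, hΦ', fun t ht => by simp at ht⟩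
  set S : Set (ℝ × ℝ) := Icc 0 τ ×ˢ Icc 0 L with hS
  set A := fderivWithin ℝ (fun p : ℝ × ℝ => φ p.1 p.2) S with hA
  have hcA : ContinuousOn A S := ContDiffOn.continuousOn_fderivWithin hφ
    ((uniqueDiffOn_Icc hτ).prod (uniqueDiffOn_Icc hL)) le_rfl
  obtain ⟨D, hD, hD'⟩ := exists_continuousOn_L2 (L := L) (τ := τ)
    (f := fun t x => -(A (t, x) (1, 0)) + A (t, x) (0, 1))
    ((hcA.clm_apply continuousOn_const).neg.add (hcA.clm_apply continuousOn_const))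
  refine ⟨Φ, D, hΦ, hD, hΦ', fun t ht => (hD' t (Ioo_subset_Icc_self ht)).trans ?_⟩
  filter_upwards [ae_restrict_mem measurableSet_Ioo] with x hx
  have hd : HasFDerivAt (fun p : ℝ × ℝ => φ p.1 p.2) (A (t, x)) (t, x) :=
    hφ.hasFDerivAt ht hx
  have h1 := hd.comp_hasDerivAt t ((hasDerivAt_id t).prodMk (hasDerivAt_const t x))
  have h2 := hd.comp_hasDerivAt x ((hasDerivAt_const x t).prodMk (hasDerivAt_id x))
  have e1 : deriv (fun s => φ s x) t = A (t, x) (1, 0) := h1.deriv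
  have e2 : deriv (fun y => φ t y) x = A (t, x) (0, 1) := h2.deriv
  rw [e1, e2]

/-- Extend the derivative by its endpoint values and integrate. -/
theorem exists_contDiff_extension {τ : ℝ} (hτ : 0 ≤ τ) {f : ℝ → ℂ}
    (hf : ContDiffOn ℝ 1 f (Icc 0 τ)) :
    ∃ h : ℝ → ℂ, ContDiff ℝ 1 h ∧ EqOn h f (Icc 0 τ) := by
  rcases hτ.eq_or_lt with rfl | hτ'
  · refine ⟨fun _ => f 0, contDiff_const, fun t ht => ?_⟩
    rw [Icc_self, mem_singleton_iff] at ht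
    rw [ht]
  set k : ℝ → ℂ := IccExtend hτ ((Icc 0 τ).domRestrict (derivWithin f (Icc 0 τ))) with hk
  have hkc : Continuous k := Continuous.Icc_extend'
    (hf.continuousOn_derivWithin (uniqueDiffOn_Icc hτ') le_rfl).domRestrict
  have hder : ∀ t, HasDerivAt (fun t => f 0 + ∫ s in (0 : ℝ)..t, k s) (k t) t := fun t =>
    (intervalIntegral.integral_hasDerivAt_right (hkc.intervalIntegrable _ _)
      hkc.stronglyMeasurable.stronglyMeasurableAtFilter hkc.continuousAt).const_add _
  refine ⟨fun t => f 0 + ∫ s in (0 : ℝ)..t, k s, ?_, fun t ht => ?_⟩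
  · rw [contDiff_one_iff_deriv]
    refine ⟨fun t => (hder t).differentiableAt, ?_⟩
    rwa [funext fun t => (hder t).deriv]
  · have : ∫ s in (0 : ℝ)..t, k s = f t - f 0 := by
      refine intervalIntegral.integral_eq_sub_of_hasDeriv_right_of_le ht.1
        (hf.continuousOn.mono (Icc_subset_Icc_right ht.2)) (fun s hs => ?_)
        (hkc.intervalIntegrable _ _)
      have hs' : s ∈ Icc 0 τ := ⟨hs.1.le, hs.2.le.trans ht.2⟩
      have hks : k s = derivWithin f (Icc 0 τ) s := by
        rw [hk, IccExtend_of_mem _ _ hs', domRestrict_apply]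
      rw [hks]
      exact (((hf.differentiableOn one_ne_zero) s hs').hasDerivWithinAt.hasDerivAt
        (Icc_mem_nhds hs.1 (hs.2.trans_le ht.2))).hasDerivWithinAt
    simp [this]

theorem weakForm_eq {L T τ : ℝ} (hτ : 0 ≤ τ) {g : ℝ → ℝ → ℂ} {K : L2 L →L[ℂ] L2 L}
    (hK : ∀ ψ : L2 L, K ψ =ᵐ[volume.restrict (Ioo 0 L)]
      fun x => ∫ y in Ioo 0 L, conj (g y x) * ψ y)
    (u₀ : L2 L) (U : L2 T) (u : ℝ → L2 L) {φ : ℝ → ℝ → ℂ} {Φ D : ℝ → L2 L}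
    (hΦ : ∀ t ∈ Icc 0 τ, Φ t =ᵐ[volume.restrict (Ioo 0 L)] φ t)
    (hD : ∀ t ∈ Ioo 0 τ, D t =ᵐ[volume.restrict (Ioo 0 L)]
        fun x => -deriv (fun s => φ s x) t + deriv (fun y => φ t y) x) :
    weakForm g u₀ U u τ φ = (∫ t in Ioo 0 τ, inner ℂ (D t - K (Φ t)) (u t))
      + inner ℂ (Φ τ) (u τ) - inner ℂ (Φ 0) u₀ - ∫ t in Ioo 0 τ, U t * conj (φ t L) := by
  have hpair : ∀ t ∈ Icc 0 τ, ∀ v : L2 L,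
      ∫ x in Ioo 0 L, v x * conj (φ t x) = inner ℂ (Φ t) v := by
    intro t ht v
    rw [L2.inner_def]
    refine integral_congr_ae ?_
    filter_upwards [hΦ t ht] with x hx
    rw [RCLike.inner_apply, hx]
  rw [weakForm, hpair τ ⟨hτ, le_rfl⟩, hpair 0 ⟨le_rfl, hτ⟩]
  congr 3
  refine setIntegral_congr_fun measurableSet_Ioo fun t ht => ?_
  rw [L2.inner_def]
  refine integral_congr_ae ?_
  filter_upwards [hD t ht, hK (Φ t), Lp.coeFn_sub (D t) (K (Φ t))] with x h1 h2 h3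
  have h4 : ∫ y in Ioo 0 L, conj (g y x) * Φ t y = ∫ y in Ioo 0 L, conj (g y x) * φ t y := by
    refine integral_congr_ae ?_
    filter_upwards [hΦ t (Ioo_subset_Icc_self ht)] with y hy
    rw [hy]
  rw [RCLike.inner_apply, h3, Pi.sub_apply, h1, h2, h4, adjointOp]

/-- Splitting the time integral requires integrability of each integrand, which follows from the
continuous representatives of `weakForm_eq`. -/
theorem weakForm_sub {L T τ : ℝ} (hL : 0 < L) (hτ : τ ∈ Icc 0 T) {g : ℝ → ℝ → ℂ}
    {K : L2 L →L[ℂ] L2 L}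
    (hK : ∀ ψ : L2 L, K ψ =ᵐ[volume.restrict (Ioo 0 L)]
      fun x => ∫ y in Ioo 0 L, conj (g y x) * ψ y)
    (u₀ : L2 L) (U : L2 T) {u : ℝ → L2 L} (hu : ContinuousOn u (Icc 0 T)) {φ ψ : ℝ → ℝ → ℂ}
    (hφ : IsTestFunction L τ φ) (hψ : IsTestFunction L τ ψ) :
    weakForm g u₀ U u τ (fun t x => φ t x - ψ t x)
      = weakForm g u₀ U u τ φ - weakForm g u₀ U u τ ψ := by
  obtain ⟨Φ, D, hΦc, hDc, hΦ, hD⟩ := exists_test_representatives hL hτ.1 hφ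
  obtain ⟨Ψ, E, hΨc, hEc, hΨ, hE⟩ := exists_test_representatives hL hτ.1 hψ
  have huτ : ContinuousOn u (Icc 0 τ) := hu.mono (Icc_subset_Icc_right hτ.2)
  have hint : ∀ {Φ D : ℝ → L2 L}, ContinuousOn Φ (Icc 0 τ) → ContinuousOn D (Icc 0 τ) →
      IntegrableOn (fun t => inner ℂ (D t - K (Φ t)) (u t)) (Ioo 0 τ) := fun hΦ hD =>
    ((ContinuousOn.inner (𝕜 := ℂ) (hD.sub (K.continuous.comp_continuousOn hΦ))
      huτ).integrableOn_compact
      isCompact_Icc).mono_set Ioo_subset_Icc_self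
  have hLmem : L ∈ Icc 0 L := ⟨hL.le, le_rfl⟩
  rw [weakForm_eq hτ.1 hK u₀ U u (Φ := Φ) (D := D) hΦ hD,
    weakForm_eq hτ.1 hK u₀ U u (Φ := Ψ) (D := E) hΨ hE,
    weakForm_eq hτ.1 hK u₀ U u (Φ := Φ - Ψ) (D := D - E)]
  · have e1 : ∫ t in Ioo 0 τ, inner ℂ ((D - E) t - K ((Φ - Ψ) t)) (u t)
        = (∫ t in Ioo 0 τ, inner ℂ (D t - K (Φ t)) (u t))
          - ∫ t in Ioo 0 τ, inner ℂ (E t - K (Ψ t)) (u t) := by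
      rw [← integral_sub (hint hΦc hDc) (hint hΨc hEc)]
      refine integral_congr_ae (Filter.Eventually.of_forall fun t => ?_)
      simp only [Pi.sub_apply, map_sub, inner_sub_left]
      ring
    have e2 : ∫ t in Ioo 0 τ, U t * conj (φ t L - ψ t L)
        = (∫ t in Ioo 0 τ, U t * conj (φ t L)) - ∫ t in Ioo 0 τ, U t * conj (ψ t L) := by
      rw [← integral_sub (hφ.integrableOn_mul hτ U hLmem) (hψ.integrableOn_mul hτ U hLmem)]
      simp only [map_sub, mul_sub]
    rw [e1, e2]
    simp only [Pi.sub_apply, inner_sub_left]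
    ring
  · intro t ht
    filter_upwards [hΦ t ht, hΨ t ht, Lp.coeFn_sub (Φ t) (Ψ t)] with x h1 h2 h3
    rw [Pi.sub_apply, h3, Pi.sub_apply, h1, h2]
  · intro t ht
    filter_upwards [hD t ht, hE t ht, Lp.coeFn_sub (D t) (E t),
      ae_restrict_mem measurableSet_Ioo] with x h1 h2 h3 hx
    have d1 := deriv_sub (hφ.differentiableAt_left ht hx) (hψ.differentiableAt_left ht hx)
    have d2 := deriv_sub (hφ.differentiableAt_right ht hx) (hψ.differentiableAt_right ht hx)
    rw [Pi.sub_apply, h3, Pi.sub_apply, h1, h2]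
    change _ = -deriv ((fun s => φ s x) - fun s => ψ s x) t
      + deriv ((fun y => φ t y) - fun y => ψ t y) x
    rw [d1, d2]
    ring

/-! ### Weighted profiles constant along characteristics -/

/-- The affine weight equal to `1` at `0` and to `0` at `L`. -/
def weight (L x : ℝ) : ℂ := ((1 - x / L : ℝ) : ℂ)

theorem weight_zero (L : ℝ) : weight L 0 = 1 := by simp [weight]

theorem weight_self {L : ℝ} (hL : 0 < L) : weight L L = 0 := by simp [weight, hL.ne']

theorem hasDerivAt_weight (L x : ℝ) : HasDerivAt (weight L) (-(1 / L : ℂ)) x := by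
  have h : HasDerivAt (fun x : ℝ => 1 - x / L) (-(1 / L)) x :=
    ((hasDerivAt_id x).div_const L).const_sub 1
  have h' := h.ofReal_comp
  rw [Complex.ofReal_neg, Complex.ofReal_div, Complex.ofReal_one] at h'
  exact h'

theorem contDiff_weight (L : ℝ) : ContDiff ℝ 1 (weight L) :=
  Complex.ofRealCLM.contDiff.comp (f := fun x : ℝ => 1 - x / L) (by fun_prop)

theorem exists_weight_operator (L : ℝ) :
    ∃ M : L2 L →L[ℂ] L2 L, ∀ ψ : L2 L,
      M ψ =ᵐ[volume.restrict (Ioo 0 L)] fun x => weight L x * ψ x := by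
  have hc : Continuous (weight L) := (contDiff_weight L).continuous
  obtain ⟨C, hC⟩ := (isCompact_Icc (a := 0) (b := L)).exists_bound_of_continuousOn hc.continuousOn
  have hm : MemLp (weight L) ∞ (volume.restrict (Ioo 0 L)) := by
    refine memLp_top_of_bound hc.aestronglyMeasurable C ?_
    filter_upwards [ae_restrict_mem measurableSet_Ioo] with x hx
    exact hC x (Ioo_subset_Icc_self hx)
  refine ⟨(ContinuousLinearMap.mul ℂ ℂ).holderL _ ∞ 2 2 hm.toLp, fun ψ => ?_⟩
  have h := (ContinuousLinearMap.mul ℂ ℂ).coeFn_holder (r := 2) hm.toLp ψ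
  refine h.trans ?_
  filter_upwards [hm.coeFn_toLp] with x hx
  rw [hx, ContinuousLinearMap.mul_apply']

theorem isTestFunction_weight_mul {L τ : ℝ} {h : ℝ → ℂ} (hh : ContDiff ℝ 1 h) :
    IsTestFunction L τ fun t x => weight L x * h (t + x) :=
  (((contDiff_weight L).comp contDiff_snd).mul
    (hh.comp (contDiff_fst.add contDiff_snd))).contDiffOn

/-- Restriction of functions on the line to `(0, L)`. -/
abbrev restrictL2 (L : ℝ) : Lp ℂ 2 (volume : Measure ℝ) →L[ℂ] L2 L :=
  LpToLpRestrictCLM ℝ ℂ ℂ volume 2 (Ioo 0 L)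

theorem restrictL2_translate {L T t : ℝ} (ht : t ∈ Icc 0 T) {h : ℝ → ℂ}
    {H : Lp ℂ 2 (volume : Measure ℝ)} (hH : ∀ᵐ x, x ∈ Icc 0 (T + L) → H x = h x) :
    restrictL2 L (translate t H) =ᵐ[volume.restrict (Ioo 0 L)] fun x => h (t + x) := by
  have h1 := (measurePreserving_add_left volume t).quasiMeasurePreserving.ae hH
  filter_upwards [LpToLpRestrictCLM_coeFn ℂ (Ioo 0 L) (translate t H),
    ae_restrict_of_ae (coeFn_translate t H), ae_restrict_of_ae h1,
    ae_restrict_mem measurableSet_Ioo] with x e1 e2 e3 hx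
  rw [e1, e2]
  exact e3 ⟨by linarith [ht.1, hx.1], by linarith [ht.2, hx.2]⟩

/-- The element of `L²(ℝ)` that represents the functional `h ↦ weakForm` at the test function
`weight L x * h (t + x)`. -/
def traceFunction {L : ℝ} (N P : Lp ℂ 2 (volume : Measure ℝ) →L[ℂ] L2 L) (u₀ : L2 L)
    (u : ℝ → L2 L) (τ : ℝ) : Lp ℂ 2 (volume : Measure ℝ) :=
  (∫ t in Ioo 0 τ, translate (-t) (ContinuousLinearMap.adjoint N (u t)))
    + translate (-τ) (ContinuousLinearMap.adjoint P (u τ)) - ContinuousLinearMap.adjoint P u₀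

theorem inner_traceFunction {L T τ : ℝ} (hτ : τ ∈ Icc 0 T)
    (N P : Lp ℂ 2 (volume : Measure ℝ) →L[ℂ] L2 L) (u₀ : L2 L) {u : ℝ → L2 L}
    (hu : ContinuousOn u (Icc 0 T)) (H : Lp ℂ 2 (volume : Measure ℝ)) :
    inner ℂ H (traceFunction N P u₀ u τ)
      = (∫ t in Ioo 0 τ, inner ℂ (N (translate t H)) (u t))
        + inner ℂ (P (translate τ H)) (u τ) - inner ℂ (P H) u₀ := by
  have hint : IntegrableOn (fun t => translate (-t) (ContinuousLinearMap.adjoint N (u t)))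
      (Ioo 0 τ) :=
    ((continuousOn_translate (by fun_prop) ((ContinuousLinearMap.adjoint N).continuous
      |>.comp_continuousOn (hu.mono (Icc_subset_Icc_right hτ.2)))).integrableOn_compact
        isCompact_Icc).mono_set Ioo_subset_Icc_self
  rw [traceFunction, inner_sub_right, inner_add_right, ← integral_inner hint]
  simp only [inner_translate_neg, ContinuousLinearMap.adjoint_inner_right]

theorem weakForm_weight_mul {L T τ : ℝ} (hL : 0 < L) (hτ : τ ∈ Icc 0 T) {g : ℝ → ℝ → ℂ}
    {K M : L2 L →L[ℂ] L2 L}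
    (hK : ∀ ψ : L2 L, K ψ =ᵐ[volume.restrict (Ioo 0 L)]
      fun x => ∫ y in Ioo 0 L, conj (g y x) * ψ y)
    (hM : ∀ ψ : L2 L, M ψ =ᵐ[volume.restrict (Ioo 0 L)] fun x => weight L x * ψ x)
    (u₀ : L2 L) (U : L2 T) {u : ℝ → L2 L} (hu : ContinuousOn u (Icc 0 T)) {h : ℝ → ℂ}
    (hh : ContDiff ℝ 1 h) {H : Lp ℂ 2 (volume : Measure ℝ)}
    (hH : ∀ᵐ x, x ∈ Icc 0 (T + L) → H x = h x) :
    weakForm g u₀ U u τ (fun t x => weight L x * h (t + x))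
      = inner ℂ H (traceFunction (-(1 / L : ℂ) • restrictL2 L - K ∘L M ∘L restrictL2 L)
          (M ∘L restrictL2 L) u₀ u τ) := by
  have hR : ∀ t ∈ Icc 0 τ, restrictL2 L (translate t H) =ᵐ[volume.restrict (Ioo 0 L)]
      fun x => h (t + x) := fun t ht => restrictL2_translate ⟨ht.1, ht.2.trans hτ.2⟩ hH
  have h0 : translate 0 H = H := by
    refine Lp.ext ((coeFn_translate 0 H).trans ?_)
    simp
  rw [inner_traceFunction hτ _ _ _ hu, weakForm_eq hτ.1 hK u₀ U u
    (Φ := fun t => M (restrictL2 L (translate t H)))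
    (D := fun t => -(1 / L : ℂ) • restrictL2 L (translate t H))]
  -- The weight vanishes at `L`, so the control term drops out.
  · simp [weight_self hL, h0]
  · intro t ht
    filter_upwards [hM (restrictL2 L (translate t H)), hR t ht] with x h1 h2
    rw [h1, h2]
  · intro t ht
    filter_upwards [Lp.coeFn_smul (-(1 / L : ℂ)) (restrictL2 L (translate t H)),
      hR t (Ioo_subset_Icc_self ht)] with x h1 h2
    have hd : HasDerivAt h (deriv h (t + x)) (t + x) :=
      (hh.differentiable one_ne_zero _).hasDerivAt
    have e1 : HasDerivAt (fun s => weight L x * h (s + x)) (weight L x * deriv h (t + x)) t :=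
      (hd.comp_add_const t x).const_mul _
    have e2 : HasDerivAt (fun y => weight L y * h (t + y))
        (-(1 / L : ℂ) * h (t + x) + weight L x * deriv h (t + x)) x :=
      (hasDerivAt_weight L x).mul (hd.comp_const_add t x)
    -- The two terms in `deriv h` cancel, leaving only the derivative `-1 / L` of the weight.
    rw [e1.deriv, e2.deriv, h1, Pi.smul_apply, h2, smul_eq_mul]
    ring

/-! ### Localization of the trace function -/

theorem exists_L2_eq_on_Icc {h : ℝ → ℂ} (hh : Continuous h) (a b : ℝ) :
    ∃ H : Lp ℂ 2 (volume : Measure ℝ), H =ᵐ[volume] (Icc a b).indicator h := by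
  obtain ⟨C, hC⟩ := (isCompact_Icc (a := a) (b := b)).exists_bound_of_continuousOn hh.continuousOn
  have hm : MemLp h 2 (volume.restrict (Icc a b)) := by
    refine MemLp.of_bound hh.aestronglyMeasurable C ?_
    filter_upwards [ae_restrict_mem measurableSet_Icc] with x hx
    exact hC x hx
  exact ⟨_, ((memLp_indicator_iff_restrict measurableSet_Icc).2 hm).coeFn_toLp⟩

theorem inner_eq_setIntegral {a b : ℝ} {h : ℝ → ℂ} {H : Lp ℂ 2 (volume : Measure ℝ)}
    (hH : H =ᵐ[volume] (Icc a b).indicator h) (w : Lp ℂ 2 (volume : Measure ℝ)) :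
    inner ℂ H w = ∫ x in Icc a b, w x * conj (h x) := by
  rw [L2.inner_def, ← integral_indicator measurableSet_Icc]
  refine integral_congr_ae ?_
  filter_upwards [hH] with x hx
  rw [RCLike.inner_apply, hx]
  by_cases hx' : x ∈ Icc a b <;> simp [hx']

/-- An element of `L²(ℝ)` that is orthogonal to the smooth functions with compact support in an
open subset of `[a, b]` vanishes there. -/
theorem ae_eq_zero_of_forall_inner {a b : ℝ} {O : Set ℝ} (hO : IsOpen O) (hOab : O ⊆ Icc a b)
    (w : Lp ℂ 2 (volume : Measure ℝ))
    (hw : ∀ (h : ℝ → ℂ) (H : Lp ℂ 2 (volume : Measure ℝ)), ContDiff ℝ 1 h → (tsupport h ⊆ O) →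
      H =ᵐ[volume] (Icc a b).indicator h → inner ℂ H w = 0) :
    ∀ᵐ x, x ∈ O → w x = 0 := by
  refine hO.ae_eq_zero_of_integral_contDiff_smul_eq_zero
    (((Lp.memLp w).locallyIntegrable (by norm_num)).locallyIntegrableOn O) fun f hf _ hfO => ?_
  have hh : ContDiff ℝ 1 fun x => (f x : ℂ) :=
    Complex.ofRealCLM.contDiff.comp (hf.of_le (by norm_cast))
  have hsupp : tsupport (fun x => (f x : ℂ)) ⊆ O := by
    refine (closure_mono fun x hx => ?_).trans hfO
    simpa using hx
  obtain ⟨H, hH⟩ := exists_L2_eq_on_Icc hh.continuous a b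
  have h0 := hw _ H hh hsupp hH
  rw [inner_eq_setIntegral hH, setIntegral_eq_integral_of_forall_compl_eq_zero] at h0
  · rw [← h0]
    refine integral_congr_ae (Filter.Eventually.of_forall fun x => ?_)
    simp [Complex.real_smul, mul_comm]
  · intro x hx
    have : f x = 0 := by
      by_contra hne
      exact hx (hOab (hfO (subset_tsupport f hne)))
    simp [this]

/-- For `x > 0` and `t ≥ τ` the point `t + x` lies beyond the support of `h`. -/
theorem restrictL2_translate_eq_zero {L T t τ : ℝ} (ht : t ∈ Icc 0 T) (hτt : τ ≤ t) {h : ℝ → ℂ}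
    (hsupp : tsupport h ⊆ Ioo 0 τ) {H : Lp ℂ 2 (volume : Measure ℝ)}
    (hH : ∀ᵐ x, x ∈ Icc 0 (T + L) → H x = h x) :
    restrictL2 L (translate t H) = 0 := by
  refine Lp.ext ((restrictL2_translate ht hH).trans ?_)
  filter_upwards [Lp.coeFn_zero ℂ 2 ((volume : Measure ℝ).restrict (Ioo 0 L)),
    ae_restrict_mem measurableSet_Ioo] with x hx0 hx
  rw [hx0, Pi.zero_apply]
  by_contra hne
  have := (hsupp (subset_tsupport h hne)).2
  linarith [hx.1]

/-- A profile supported in `(0, τ)` has left `(0, L)` by time `τ`, so the evolution after `τ` and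
both final-time terms contribute nothing. -/
theorem traceFunction_ae_eq {L T τ : ℝ} (hL : 0 < L) (hT : 0 < T) (hτ : τ ∈ Icc 0 T)
    (A B : L2 L →L[ℂ] L2 L) (u₀ : L2 L) {u : ℝ → L2 L} (hu : ContinuousOn u (Icc 0 T)) :
    ∀ᵐ x, x ∈ Ioo 0 τ → traceFunction (A ∘L restrictL2 L) (B ∘L restrictL2 L) u₀ u T x
      = traceFunction (A ∘L restrictL2 L) (B ∘L restrictL2 L) u₀ u τ x := by
  set w := traceFunction (A ∘L restrictL2 L) (B ∘L restrictL2 L) u₀ u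
  have h := ae_eq_zero_of_forall_inner (a := 0) (b := T + L) (isOpen_Ioo (a := 0) (b := τ))
    (fun x hx => ⟨hx.1.le, by linarith [hx.2, hτ.2]⟩) (w T - w τ) ?_
  · filter_upwards [h, Lp.coeFn_sub (w T) (w τ)] with x hx hx' hxO
    rw [← sub_eq_zero, ← hx hxO, hx', Pi.sub_apply]
  · intro h H _ hsupp hH
    have hH' : ∀ᵐ x, x ∈ Icc 0 (T + L) → H x = h x := by
      filter_upwards [hH] with x hx hxI
      rw [hx, indicator_of_mem hxI]
    have hz : ∀ t ∈ Icc 0 T, τ ≤ t → restrictL2 L (translate t H) = 0 := fun t ht hτt =>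
      restrictL2_translate_eq_zero ht hτt hsupp hH'
    have hi : ∫ t in Ioo 0 T, inner ℂ ((A ∘L restrictL2 L) (translate t H)) (u t)
        = ∫ t in Ioo 0 τ, inner ℂ ((A ∘L restrictL2 L) (translate t H)) (u t) := by
      refine setIntegral_eq_of_subset_of_forall_sdiff_eq_zero measurableSet_Ioo
        (Ioo_subset_Ioo_right hτ.2) fun t ht => ?_
      rw [ContinuousLinearMap.comp_apply, hz t (Ioo_subset_Icc_self ht.1)
        (not_lt.1 fun hlt => ht.2 ⟨ht.1.1, hlt⟩), map_zero, inner_zero_left]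
    rw [inner_sub_right, inner_traceFunction ⟨hT.le, le_rfl⟩ _ _ _ hu,
      inner_traceFunction hτ _ _ _ hu, hi, ContinuousLinearMap.comp_apply B _ (translate T H),
      ContinuousLinearMap.comp_apply B _ (translate τ H), hz T ⟨hT.le, le_rfl⟩ hτ.2, hz τ hτ le_rfl]
    simp

/-! ### Hidden regularity of the boundary trace -/

/-- Hidden regularity: if the weak form vanishes at every test function that satisfies the boundary
condition `φ(t, 0) = c φ(t, L)`, then it is given by an `L²` function of time in general. -/
theorem exists_boundary_trace {L T : ℝ} (hL : 0 < L) (hT : 0 < T) {g : ℝ → ℝ → ℂ}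
    (hg : MemLp (fun p : ℝ × ℝ => g p.1 p.2) 2
      ((volume : Measure (ℝ × ℝ)).restrict (Ioo 0 L ×ˢ Ioo 0 L)))
    (c : ℂ) (u₀ : L2 L) (U : L2 T) {u : ℝ → L2 L} (hu : ContinuousOn u (Icc 0 T))
    (hweak : ∀ τ ∈ Icc 0 T, ∀ φ : ℝ → ℝ → ℂ, IsTestFunction L τ φ →
      (∀ t ∈ Icc 0 τ, φ t 0 = c * φ t L) → weakForm g u₀ U u τ φ = 0) :
    ∃ v : L2 T, ∀ τ ∈ Icc 0 T, ∀ φ : ℝ → ℝ → ℂ, IsTestFunction L τ φ →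
      weakForm g u₀ U u τ φ = ∫ t in Ioo 0 τ, v t * conj (φ t 0 - c * φ t L) := by
  have hk : MemLp (fun p : ℝ × ℝ => conj (g p.2 p.1)) 2
      (((volume : Measure ℝ).restrict (Ioo 0 L)).prod (volume.restrict (Ioo 0 L))) := by
    rw [Measure.volume_eq_prod, ← Measure.prod_restrict] at hg
    exact (hg.comp_measurePreserving Measure.measurePreserving_swap).star
  obtain ⟨K, hK⟩ := exists_kernel_operator (k := fun x y => conj (g y x)) hk
  obtain ⟨M, hM⟩ := exists_weight_operator L
  set w := traceFunction ((-(1 / L : ℂ) • ContinuousLinearMap.id ℂ (L2 L) - K ∘L M) ∘L restrictL2 L)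
    (M ∘L restrictL2 L) u₀ u with hw
  have hform : ∀ τ ∈ Icc 0 T, ∀ (h : ℝ → ℂ) (H : Lp ℂ 2 (volume : Measure ℝ)), ContDiff ℝ 1 h →
      H =ᵐ[volume] (Icc 0 (T + L)).indicator h →
      weakForm g u₀ U u τ (fun t x => weight L x * h (t + x)) = inner ℂ H (w τ) := by
    intro τ hτ h H hh hH
    refine weakForm_weight_mul hL hτ hK hM u₀ U hu hh ?_
    filter_upwards [hH] with x hx hxI
    rw [hx, indicator_of_mem hxI]
  -- If `h` is supported beyond `τ`, the weighted profile vanishes at both endpoints for `t ≤ τ`, so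
  -- it is admissible for every `c`.
  have hout : ∀ τ ∈ Icc 0 T, ∀ᵐ x, x ∈ Ioo τ (T + L) → w τ x = 0 := by
    intro τ hτ
    refine ae_eq_zero_of_forall_inner isOpen_Ioo
      (fun x hx => ⟨hτ.1.trans hx.1.le, hx.2.le⟩) (w τ) fun h H hh hsupp hH => ?_
    rw [← hform τ hτ h H hh hH]
    refine hweak τ hτ _ (isTestFunction_weight_mul hh) fun t ht => ?_
    have : h t = 0 := by
      by_contra hne
      have := (hsupp (subset_tsupport h hne)).1
      linarith [ht.2]
    simp [weight_self hL, this]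
  refine ⟨LpToLpRestrictCLM ℝ ℂ ℂ volume 2 (Ioo 0 T) (w T), fun τ hτ φ hφ => ?_⟩
  have hτL : τ ≤ T + L := by linarith [hτ.2]
  have hbd : ∀ x ∈ Icc 0 L, ContDiffOn ℝ 1 (fun t => φ t x) (Icc 0 τ) := fun x hx =>
    ContDiffOn.comp (f := fun t : ℝ => (t, x)) hφ (by fun_prop) fun t ht => ⟨ht, hx⟩
  obtain ⟨h, hh, hheq⟩ := exists_contDiff_extension hτ.1
    (f := fun t => φ t 0 - c * φ t L) ((hbd 0 ⟨le_rfl, hL.le⟩).sub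
      (contDiffOn_const.mul (hbd L ⟨hL.le, le_rfl⟩)))
  obtain ⟨H, hH⟩ := exists_L2_eq_on_Icc hh.continuous 0 (T + L)
  have hψ : IsTestFunction L τ fun t x => weight L x * h (t + x) := isTestFunction_weight_mul hh
  -- At `x = 0` the profile equals `h t`, at `x = L` it is zero, so the difference satisfies the
  -- boundary condition.
  have hzero := hweak τ hτ (fun t x => φ t x - weight L x * h (t + x)) (ContDiffOn.sub hφ hψ)
    fun t ht => by
      have := hheq ht
      simp only at this
      simp only [weight_zero, weight_self hL, add_zero, this]
      ring
  rw [weakForm_sub hL hτ hK u₀ U hu hφ hψ, sub_eq_zero] at hzero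
  rw [hzero, hform τ hτ h H hh hH, inner_eq_setIntegral hH, integral_Icc_eq_integral_Ioo,
    -- The arbitrary extension of `h` past `τ` does not matter, because `w τ` vanishes there.
    setIntegral_eq_of_subset_of_ae_sdiff_eq_zero (s := Ioo 0 τ)
      measurableSet_Ioo.nullMeasurableSet (Ioo_subset_Ioo_right hτL)]
  · refine integral_congr_ae ?_
    filter_upwards [ae_restrict_of_ae (traceFunction_ae_eq hL hT hτ _ M u₀ hu),
      ae_restrict_of_ae_restrict_of_subset (Ioo_subset_Ioo_right hτ.2)
        (LpToLpRestrictCLM_coeFn ℂ (Ioo 0 T) (w T)),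
      ae_restrict_mem measurableSet_Ioo] with x h1 h2 hx
    rw [h2, ← h1 hx, hheq (Ioo_subset_Icc_self hx)]
  · have hne : ∀ᵐ x : ℝ, x ≠ τ := by simp [ae_iff]
    filter_upwards [hout τ hτ, hne] with x hx hxτ hmem
    rw [hx ⟨lt_of_le_of_ne (not_lt.1 fun hlt => hmem.2 ⟨hmem.1.1, hlt⟩) hxτ.symm, hmem.1.2⟩,
      zero_mul]

/-! ### Exchange of the boundary conditions -/

theorem weakForm_control_congr {L T τ : ℝ} (hL : 0 < L) (hτ : τ ∈ Icc 0 T) (g : ℝ → ℝ → ℂ)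
    (u₀ : L2 L) (U v : L2 T) (u : ℝ → L2 L) {φ : ℝ → ℝ → ℂ} (hφ : IsTestFunction L τ φ) :
    weakForm g u₀ (U + v) u τ φ
      = weakForm g u₀ U u τ φ - ∫ t in Ioo 0 τ, v t * conj (φ t L) := by
  have hLmem : L ∈ Icc 0 L := ⟨hL.le, le_rfl⟩
  have h : ∫ t in Ioo 0 τ, (U + v) t * conj (φ t L)
      = (∫ t in Ioo 0 τ, U t * conj (φ t L)) + ∫ t in Ioo 0 τ, v t * conj (φ t L) := by
    rw [← integral_add (hφ.integrableOn_mul hτ U hLmem) (hφ.integrableOn_mul hτ v hLmem)]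
    refine integral_congr_ae ?_
    filter_upwards [ae_restrict_of_ae_restrict_of_subset (Ioo_subset_Ioo_right hτ.2)
      (Lp.coeFn_add U v)] with t ht
    rw [ht, Pi.add_apply, add_mul]
  rw [weakForm, weakForm, h]
  ring

theorem IsDirichletSolution.exists_isPeriodicSolution {L T : ℝ} (hL : 0 < L) (hT : 0 < T)
    {g : ℝ → ℝ → ℂ}
    (hg : MemLp (fun p : ℝ × ℝ => g p.1 p.2) 2
      ((volume : Measure (ℝ × ℝ)).restrict (Ioo 0 L ×ˢ Ioo 0 L)))
    {u₀ : L2 L} {U : L2 T} {u : ℝ → L2 L} (h : IsDirichletSolution g u₀ U u) :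
    ∃ V : L2 T, IsPeriodicSolution g u₀ V u := by
  obtain ⟨v, hv⟩ := exists_boundary_trace hL hT hg 0 u₀ U h.1 fun τ hτ φ hφ hb =>
    h.2 τ hτ φ hφ fun t ht => by rw [hb t ht, zero_mul]
  -- Formally `v = -u(·, 0)`, so the new control is `u(·, L) - u(·, 0)`.
  refine ⟨U + v, h.1, fun τ hτ φ hφ hb => ?_⟩
  rw [weakForm_control_congr hL hτ g u₀ U v u hφ, hv τ hτ φ hφ, sub_eq_zero]
  refine setIntegral_congr_fun measurableSet_Ioo fun t ht => ?_
  simp only [hb t (Ioo_subset_Icc_self ht), zero_mul, sub_zero]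

theorem IsPeriodicSolution.exists_isDirichletSolution {L T : ℝ} (hL : 0 < L) (hT : 0 < T)
    {g : ℝ → ℝ → ℂ}
    (hg : MemLp (fun p : ℝ × ℝ => g p.1 p.2) 2
      ((volume : Measure (ℝ × ℝ)).restrict (Ioo 0 L ×ˢ Ioo 0 L)))
    {u₀ : L2 L} {U : L2 T} {u : ℝ → L2 L} (h : IsPeriodicSolution g u₀ U u) :
    ∃ V : L2 T, IsDirichletSolution g u₀ V u := by
  obtain ⟨v, hv⟩ := exists_boundary_trace hL hT hg 1 u₀ U h.1 fun τ hτ φ hφ hb =>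
    h.2 τ hτ φ hφ fun t ht => by rw [hb t ht, one_mul]
  -- Formally this adds `u(·, 0)` to `u(·, L) - u(·, 0)`.
  refine ⟨U + -v, h.1, fun τ hτ φ hφ hb => ?_⟩
  rw [weakForm_control_congr hL hτ g u₀ U (-v) u hφ, hv τ hτ φ hφ, sub_eq_zero]
  refine integral_congr_ae ?_
  filter_upwards [ae_restrict_of_ae_restrict_of_subset (Ioo_subset_Ioo_right hτ.2)
    (Lp.coeFn_neg v), ae_restrict_mem measurableSet_Ioo] with t ht htτ
  rw [ht, Pi.neg_apply, hb t (Ioo_subset_Icc_self htτ)]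
  simp

end IntegroHyperbolic

end

theorem mainTheorem3 (L T : ℝ) (hL : 0 < L) (hT : 0 < T) (g : ℝ → ℝ → ℂ)
    (hg : MemLp (fun p : ℝ × ℝ => g p.1 p.2) 2
      ((volume : Measure (ℝ × ℝ)).restrict (Ioo 0 L ×ˢ Ioo 0 L))) :
    IntegroHyperbolic.DirichletExactlyControllable L T g ↔
      IntegroHyperbolic.PeriodicExactlyControllable L T g := by
  constructor
  · intro h u₀ u₁
    obtain ⟨U, u, hu, hT₁⟩ := h u₀ u₁
    obtain ⟨V, hV⟩ := hu.exists_isPeriodicSolution hL hT hg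
    exact ⟨V, u, hV, hT₁⟩
  · intro h u₀ u₁
    obtain ⟨U, u, hu, hT₁⟩ := h u₀ u₁
    obtain ⟨V, hV⟩ := hu.exists_isDirichletSolution hL hT hg
    exact ⟨V, u, hV, hT₁⟩
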